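/- Let $H^A=\mathbb C^{d_A}$ and $H^B=\mathbb C^{d_B}$, and suppose that $\{\Pi_t\}_{t=1}^{d_A+1}$, $\Pi_t=\{|b_{ti}\rangle : i=1,\dots,d_A\}$, is a complete set of mutually unbiased bases of $H^A$, that is, $d_A+1$ orthonormal bases with $|\langle b_{sj}|b_{tk}\rangle|=1/\sqrt{d_A}$ for all $s\ne t$ and all $j,k$. (Such sets exist when $d_A$ is a prime power.) For a density operator $\rho$ and a Hermitian operator $O$, let $I(\rho,O)=-\frac12\operatorname{tr}\big([\sqrt\rho,O]^2\big)$ be the Wigner–Yanase skew information. For a density operator $\rho^{AB}$ on $H^A\otimes H^B$ with reduced states $\rho^A=\operatorname{tr}_B\rho^{AB}$ and $\rho^B=\operatorname{tr}_A\rho^{AB}$, and an orthonormal basis $\Pi=\{|i\rangle\}$ of $H^A$, put $$C(\rho^{AB}|\Pi\otimes\mathbb I_B)=\sum_{i=1}^{d_A} I\big(\rho^{AB},|i\rangle\langle i|\otimes \mathbf 1^B\big),\qquad Q(\rho^{AB}|\Pi)=C(\rho^{AB}|\Pi\otimes\mathbb I_B)-C(\rho^A\otimes\rho^B|\Pi\otimes\mathbb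 I_B),$$ $$Q_{mub}(\rho^{AB})=\frac1{d_A+1}\sum_{t=1}^{d_A+1}Q(\rho^{AB}|\Pi_t).$$ Then, for every density operator $\rho^{AB}$ on $H^A\otimes H^B$: (a) (Non-negativity) $Q_{mub}(\rho^{AB})\ge 0$, and equality holds if $\rho^{AB}=\rho^A\otimes\rho^B$ is a product state. (b) (Contractivity) For every quantum channel (completely positive trace-preserving linear map) $\Phi$ from operators on $H^B$ to operators on a space $\mathbb C^{d_B'}$ (for instance $d_B'=d_B$), $$Q_{mub}\big((\mathcal I_A\otimes\Phi)(\rho^{AB})\big)\le Q_{mub}(\rho^{AB}),$$ where $\mathcal I_A$ is the identity channel on $A$ and both sides use the same bases $\Pi_t$. (c) (Local unitary invariance) For all unitary operators $U_A$ on $H^A$ and $U_B$ on $H^B$, $$Q_{mub}\big((U_A\otimes U_B)\,\rho^{AB}\,(U_A\otimes U_B)^\dagger\big)=Q_{mub}(\rho^{AB}),$$ and $$Q_{mub}(\rho^{AB})=\frac{\big(\operatorname{tr}\sqrt{\rho^A}\big)^2-\operatorname{tr}_B\Big[\big(\operatorname{tr}_A\sqrt{\rho^{AB}}\big)^2\Big]}{d_A+1}.$$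 -/

import Mathlib

open Matrix
open scoped Kronecker MatrixOrder ComplexOrder

namespace AvgCorrelation

/-- A quantum state (density operator): a positive semidefinite matrix of trace one. -/
def IsState {n : Type*} [Fintype n] (ρ : Matrix n n ℂ) : Prop :=
  ρ.PosSemidef ∧ ρ.trace = 1

/-- Partial trace over the second tensor factor. -/
def traceB {a b : Type*} [Fintype b] (M : Matrix (a × b) (a × b) ℂ) : Matrix a a ℂ :=
  Matrix.of fun i j => ∑ k, M (i, k) (j, k)

/-- Partial trace over the first tensor factor. -/
def traceA {a b : Type*} [Fintype a] (M : Matrix (a × b) (a × b) ℂ) : Matrix b b ℂ :=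
  Matrix.of fun k l => ∑ i, M (i, k) (i, l)

/-- The Wigner-Yanase skew information `I(ρ, O) = -(1/2) tr [√ρ, O]²`, with `√ρ` the positive
semidefinite square root.  The trace is real for Hermitian `O`, see `coe_skewInfo`. -/
noncomputable def skewInfo {n : Type*} [Fintype n] [DecidableEq n] (ρ O : Matrix n n ℂ) : ℝ :=
  (-(1 / 2 : ℂ) * ((CFC.sqrt ρ * O - O * CFC.sqrt ρ) ^ 2).trace).re

/-- An orthonormal basis of `ℂ^d`, indexed by `Fin d`. -/
abbrev ONB (d : ℕ) : Type := OrthonormalBasis (Fin d) ℂ (EuclideanSpace ℂ (Fin d))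

/-- The rank-one projection `|v⟩⟨v|`. -/
def ketbra {d : ℕ} (v : EuclideanSpace ℂ (Fin d)) : Matrix (Fin d) (Fin d) ℂ :=
  Matrix.of fun i j => v i * star (v j)

/-- The coherence `C(ρ | P) = ∑ᵢ I(ρ, |i⟩⟨i|)`. -/
noncomputable def coherence {d : ℕ} (ρ : Matrix (Fin d) (Fin d) ℂ) (P : ONB d) : ℝ :=
  ∑ i, skewInfo ρ (ketbra (P i))

/-- The partial coherence `C(ρ | P ⊗ 𝕀_B) = ∑ᵢ I(ρ, |i⟩⟨i| ⊗ 1)`. -/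
noncomputable def partialCoherence {dA dB : ℕ}
    (ρ : Matrix (Fin dA × Fin dB) (Fin dA × Fin dB) ℂ) (P : ONB dA) : ℝ :=
  ∑ i, skewInfo ρ (ketbra (P i) ⊗ₖ (1 : Matrix (Fin dB) (Fin dB) ℂ))

/-- The correlation `Q(ρ | P) = C(ρ | P ⊗ 𝕀_B) - C(ρ^A ⊗ ρ^B | P ⊗ 𝕀_B)`.
For states the second term is `C(ρ^A | P)`, see `correlation_eq`. -/
noncomputable def correlation {dA dB : ℕ}
    (ρ : Matrix (Fin dA × Fin dB) (Fin dA × Fin dB) ℂ) (P : ONB dA) : ℝ :=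
  partialCoherence ρ P - partialCoherence (traceB ρ ⊗ₖ traceA ρ) P

/-- Two orthonormal bases of `ℂ^d` are mutually unbiased. -/
def MutuallyUnbiased {d : ℕ} (P₁ P₂ : ONB d) : Prop :=
  ∀ j k, ‖inner ℂ (P₁ j) (P₂ k)‖ = 1 / √(d : ℝ)

/-- A complete set of mutually unbiased bases of `ℂ^d`: `d + 1` orthonormal bases, any two of
which are mutually unbiased. -/
def IsCompleteMUB {d : ℕ} (B : Fin (d + 1) → ONB d) : Prop :=
  ∀ s t, s ≠ t → MutuallyUnbiased (B s) (B t)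

/-- The average correlation `(1/(d_A+1)) ∑ₜ Q(ρ | Pₜ)` over `d_A + 1` bases of the first factor. -/
noncomputable def Qmub {dA dB : ℕ} (B : Fin (dA + 1) → ONB dA)
    (ρ : Matrix (Fin dA × Fin dB) (Fin dA × Fin dB) ℂ) : ℝ :=
  1 / ((dA : ℝ) + 1) * ∑ t, correlation ρ (B t)

/-- The map `id ⊗ Φ`: apply `Φ` to each block `(M (i, ·) (j, ·))`. -/
def idTensor {a b c : Type*} (Φ : Matrix b b ℂ →ₗ[ℂ] Matrix c c ℂ)
    (M : Matrix (a × b) (a × b) ℂ) : Matrix (a × c) (a × c) ℂ :=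
  Matrix.of fun p q => Φ (Matrix.of fun k l => M (p.1, k) (q.1, l)) p.2 q.2

/-- A quantum channel: a completely positive trace-preserving linear map. -/
def IsChannel {b c : Type*} [Fintype b] [Fintype c]
    (Φ : Matrix b b ℂ →ₗ[ℂ] Matrix c c ℂ) : Prop :=
  (∀ (n : ℕ) (M : Matrix (Fin n × b) (Fin n × b) ℂ),
    M.PosSemidef → (idTensor Φ M).PosSemidef) ∧
  ∀ X, (Φ X).trace = X.trace

theorem idTensor_kronecker {a b c : Type*} (Φ : Matrix b b ℂ →ₗ[ℂ] Matrix c c ℂ)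
    (X : Matrix a a ℂ) (Y : Matrix b b ℂ) : idTensor Φ (X ⊗ₖ Y) = X ⊗ₖ Φ Y := by
  ext ⟨i, k⟩ ⟨j, l⟩
  have h : (Matrix.of fun k l => X i j * Y k l) = X i j • Y := by
    ext; simp
  simp [idTensor, Matrix.kroneckerMap_apply, h]

theorem ketbra_isHermitian {d : ℕ} (v : EuclideanSpace ℂ (Fin d)) : (ketbra v).IsHermitian := by
  ext i j
  simp [ketbra, mul_comm]

theorem coe_skewInfo {n : Type*} [Fintype n] [DecidableEq n] (ρ O : Matrix n n ℂ)
    (hO : O.IsHermitian) :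
    (skewInfo ρ O : ℂ) =
      -(1 / 2 : ℂ) * ((CFC.sqrt ρ * O - O * CFC.sqrt ρ) ^ 2).trace := by
  have hs : (CFC.sqrt ρ)ᴴ = CFC.sqrt ρ := (CFC.sqrt_nonneg ρ).posSemidef.1
  have hC : (CFC.sqrt ρ * O - O * CFC.sqrt ρ)ᴴ = -(CFC.sqrt ρ * O - O * CFC.sqrt ρ) := by
    rw [conjTranspose_sub, conjTranspose_mul, conjTranspose_mul, hs, hO.eq, neg_sub]
  have ht : star ((CFC.sqrt ρ * O - O * CFC.sqrt ρ) ^ 2).trace =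
      ((CFC.sqrt ρ * O - O * CFC.sqrt ρ) ^ 2).trace := by
    rw [← trace_conjTranspose, conjTranspose_pow, hC, neg_sq]
  refine Complex.conj_eq_iff_re.mp ?_
  rw [map_mul, starRingEnd_apply, starRingEnd_apply, ht]
  simp

theorem sqrt_kronecker {m n : Type*} [Fintype m] [DecidableEq m] [Fintype n] [DecidableEq n]
    {σ : Matrix m m ℂ} {τ : Matrix n n ℂ} (hσ : σ.PosSemidef) (hτ : τ.PosSemidef) :
    CFC.sqrt (σ ⊗ₖ τ) = CFC.sqrt σ ⊗ₖ CFC.sqrt τ := by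
  rw [CFC.sqrt_eq_iff _ _ (hσ.kronecker hτ).nonneg
    ((CFC.sqrt_nonneg σ).posSemidef.kronecker (CFC.sqrt_nonneg τ).posSemidef).nonneg,
    ← mul_kronecker_mul, CFC.sqrt_mul_sqrt_self σ hσ.nonneg, CFC.sqrt_mul_sqrt_self τ hτ.nonneg]

theorem skewInfo_kronecker {m n : Type*} [Fintype m] [DecidableEq m] [Fintype n] [DecidableEq n]
    {σ : Matrix m m ℂ} {τ : Matrix n n ℂ} (hσ : IsState σ) (hτ : IsState τ) (O : Matrix m m ℂ) :
    skewInfo (σ ⊗ₖ τ) (O ⊗ₖ (1 : Matrix n n ℂ)) = skewInfo σ O := by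
  have h : CFC.sqrt σ ⊗ₖ CFC.sqrt τ * O ⊗ₖ (1 : Matrix n n ℂ)
      - O ⊗ₖ (1 : Matrix n n ℂ) * CFC.sqrt σ ⊗ₖ CFC.sqrt τ
      = (CFC.sqrt σ * O - O * CFC.sqrt σ) ⊗ₖ CFC.sqrt τ := by
    rw [← mul_kronecker_mul, ← mul_kronecker_mul, mul_one, one_mul]
    ext ⟨i, k⟩ ⟨j, l⟩
    simp [kroneckerMap_apply, sub_mul]
  unfold skewInfo
  rw [sqrt_kronecker hσ.1 hτ.1, h, pow_two, ← mul_kronecker_mul, trace_kronecker,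
    CFC.sqrt_mul_sqrt_self τ hτ.1.nonneg, hτ.2, mul_one, ← pow_two]

theorem IsState.traceB {a b : Type*} [Fintype a] [Fintype b]
    {ρ : Matrix (a × b) (a × b) ℂ} (hρ : IsState ρ) : IsState (traceB ρ) := by
  refine ⟨?_, ?_⟩
  · have h : AvgCorrelation.traceB ρ
        = ∑ k, ρ.submatrix (fun i : a => (i, k)) (fun i : a => (i, k)) := by
      ext i j
      simp [AvgCorrelation.traceB, Matrix.sum_apply]
    rw [h]
    exact posSemidef_sum _ fun k _ => hρ.1.submatrix _
  · rw [← hρ.2]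
    simp [Matrix.trace, AvgCorrelation.traceB, Fintype.sum_prod_type]

theorem IsState.traceA {a b : Type*} [Fintype a] [Fintype b]
    {ρ : Matrix (a × b) (a × b) ℂ} (hρ : IsState ρ) : IsState (traceA ρ) := by
  refine ⟨?_, ?_⟩
  · have h : AvgCorrelation.traceA ρ
        = ∑ i, ρ.submatrix (fun k : b => (i, k)) (fun k : b => (i, k)) := by
      ext i j
      simp [AvgCorrelation.traceA, Matrix.sum_apply]
    rw [h]
    exact posSemidef_sum _ fun k _ => hρ.1.submatrix _
  · rw [← hρ.2]
    simp [Matrix.trace, AvgCorrelation.traceA, Fintype.sum_prod_type_right]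

/-- For states, `Q(ρ | P) = C(ρ | P ⊗ 𝕀_B) - C(ρ^A | P)`. -/
theorem correlation_eq {dA dB : ℕ} {ρ : Matrix (Fin dA × Fin dB) (Fin dA × Fin dB) ℂ}
    (hρ : IsState ρ) (P : ONB dA) :
    correlation ρ P = partialCoherence ρ P - coherence (traceB ρ) P := by
  simp only [correlation, coherence]
  congr 1
  exact Finset.sum_congr rfl fun i _ => skewInfo_kronecker hρ.traceB hρ.traceA _

end AvgCorrelation

open AvgCorrelation

namespace AvgCorrelation

/-! Two facts carry the theorem. The first is algebraic. For a projection `K`, the skew information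
is `tr ρK - tr √ρ K √ρ K`. The projections `K` of a complete MUB set form a projective 2-design: `∑
K ⊗ K = 1 + swap`. In the sum over all bases the quadratic term thus becomes `tr ρ + tr (tr_A √ρ)²`,
which no longer sees the bases. Subtracting the same sum for `ρ^A ⊗ ρ^B` gives the closed form, and
local unitary invariance is then immediate.

The second is analytic. The form `X ↦ tr (√R X† √R X)` on the retained factor does not decrease when
`R` is replaced by its partial trace (`re_trace_sqrt_le_traceB`). This is proved in the
Pusz–Woronowicz manner. Cauchy–Schwarz bounds the sesquilinear form by `X ↦ tr (R X†X)` and `Y ↦ tr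
(R YY†)`, which depend only on `σ = tr_B R`. In an eigenbasis of `σ` both are diagonal, and their
geometric mean is `tr (√σ X† √σ X)`; a Hermitian form so bounded lies below that mean.

Summed over matrix units of `A`, the form gives `tr (tr_A √ρ)²`. Tracing out all of `B` yields
non-negativity. Writing a channel as an isometry followed by a partial trace over the environment
yields contractivity, since the isometry changes neither `ρ^A` nor `tr (tr_A √ρ)²`. -/

/-! ### Hermitian forms below a geometric mean -/

theorem re_form_le_of_pos {ι : Type*} [Fintype ι] [DecidableEq ι] {a b : ι → ℝ}
    (ha : ∀ i, 0 < a i) (hb : ∀ i, 0 < b i) {T : Matrix ι ι ℂ} (hT : T.IsHermitian)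
    (hCS : ∀ x y : ι → ℂ, ‖star x ⬝ᵥ T *ᵥ y‖ ^ 2 ≤
      (∑ i, a i * ‖x i‖ ^ 2) * ∑ i, b i * ‖y i‖ ^ 2) (x : ι → ℂ) :
    (star x ⬝ᵥ T *ᵥ x).re ≤ ∑ i, √(a i * b i) * ‖x i‖ ^ 2 := by
  set h : ι → ℝ := fun i => √(√(a i * b i)) with hh
  have hg : ∀ i, 0 < √(a i * b i) := fun i => Real.sqrt_pos.2 (mul_pos (ha i) (hb i))
  have hpos : ∀ i, 0 < h i := fun i => Real.sqrt_pos.2 (hg i)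
  have hsq : ∀ i, h i * h i = √(a i * b i) := fun i => Real.mul_self_sqrt (hg i).le
  -- With `h = (ab)^(1/4)`, rescaling by `E` turns the geometric mean form into the identity, so the
  -- claim becomes `1 - E T E ≥ 0`, checked on eigenvalues.
  set E : Matrix ι ι ℂ := diagonal fun i => ((h i)⁻¹ : ℂ) with hE
  have hEh : Eᴴ = E := by
    rw [hE, diagonal_conjTranspose]; congr 1; ext i; simp
  have hM : (1 - E * T * E).IsHermitian := by
    simp only [IsHermitian, conjTranspose_sub, conjTranspose_one, conjTranspose_mul, hEh, hT.eq,
      mul_assoc]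
  have hP : (1 - E * T * E).PosSemidef := by
    rw [hM.posSemidef_iff_eigenvalues_nonneg]
    intro k
    set μ := hM.eigenvalues k
    set v : ι → ℂ := ⇑(hM.eigenvectorBasis k) with hv
    have hv0 : v ≠ 0 := by
      intro h0
      have := hM.eigenvectorBasis.orthonormal.ne_zero k
      exact this (by ext i; exact congrFun h0 i)
    have hev : (1 - E * T * E) *ᵥ v = μ • v := hM.mulVec_eigenvectorBasis k
    set w : ι → ℂ := E *ᵥ v with hw
    have hwi : ∀ i, w i = (h i : ℂ)⁻¹ * v i := fun i => by simp [hw, hE, mulVec_diagonal]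
    have hTw : ∀ i, (T *ᵥ w) i = ((1 - μ) * √(a i * b i) : ℝ) * w i := by
      intro i
      have h1 := congrFun hev i
      rw [sub_mulVec, one_mulVec, ← mulVec_mulVec, ← mulVec_mulVec, ← hw] at h1
      simp only [Pi.sub_apply, hE, mulVec_diagonal, Pi.smul_apply, Complex.real_smul] at h1
      have hne : (h i : ℂ) ≠ 0 := by exact_mod_cast (hpos i).ne'
      have : (T *ᵥ w) i = (h i : ℂ) * ((1 - μ) * v i) := by
        field_simp at h1
        linear_combination -h1
      rw [this, hwi, ← hsq]
      push_cast
      field_simp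
    -- The weight `s` makes the `a`-form at `s w` equal to the `b`-form at `w`, both being `N`. As
    -- `T w = (1 - μ) √(ab) w`, the Cauchy–Schwarz hypothesis reads `((1 - μ) N)² ≤ N²`, which
    -- forces `μ ≥ 0`.
    set s : ι → ℝ := fun i => √(b i / a i)
    have hs1 : ∀ i, s i * √(a i * b i) = b i := fun i => by
      rw [← Real.sqrt_mul (div_pos (hb i) (ha i)).le]
      rw [show b i / a i * (a i * b i) = b i * b i by field_simp [(ha i).ne']]
      exact Real.sqrt_mul_self (hb i).le
    have hs2 : ∀ i, a i * s i ^ 2 = b i := fun i => by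
      rw [Real.sq_sqrt (div_pos (hb i) (ha i)).le]; field_simp [(ha i).ne']
    have key := hCS (fun i => (s i : ℂ) * w i) w
    set N := ∑ i, b i * ‖w i‖ ^ 2 with hN
    have e1 : star (fun i => (s i : ℂ) * w i) ⬝ᵥ T *ᵥ w = ((1 - μ) * N : ℝ) := by
      rw [hN, Finset.mul_sum]
      push_cast
      refine Finset.sum_congr rfl fun i _ => ?_
      have hs : (s i : ℂ) * √(a i * b i) = b i := by exact_mod_cast hs1 i
      rw [hTw]
      have : star (w i) * w i = (‖w i‖ : ℂ) ^ 2 := by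
        simpa using Complex.conj_mul' (w i)
      simp only [Pi.star_apply, star_mul', Complex.star_def, Complex.conj_ofReal] at this ⊢
      push_cast
      linear_combination (s i * (1 - μ) * √(a i * b i) : ℂ) * this + (1 - μ) * (‖w i‖ : ℂ) ^ 2 * hs
    have e2 : ∑ i, a i * ‖(s i : ℂ) * w i‖ ^ 2 = N := by
      refine Finset.sum_congr rfl fun i _ => ?_
      rw [norm_mul, mul_pow, ← mul_assoc, Complex.norm_real, Real.norm_eq_abs, sq_abs, hs2]
    rw [e1, e2, Complex.norm_real, Real.norm_eq_abs, sq_abs] at key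
    have hNpos : 0 < N := by
      obtain ⟨i, hi⟩ := Function.ne_iff.1 hv0
      have hi' : v i ≠ 0 := hi
      refine Finset.sum_pos' (fun j _ => by have := hb j; positivity) ⟨i, Finset.mem_univ _, ?_⟩
      have : w i ≠ 0 := by
        rw [hwi]
        exact mul_ne_zero (inv_ne_zero (by exact_mod_cast (hpos i).ne')) hi'
      have := hb i
      positivity
    have h2 : (1 - μ) ^ 2 ≤ 1 := by
      have : (1 - μ) ^ 2 * (N * N) ≤ 1 * (N * N) := by nlinarith
      exact le_of_mul_le_mul_right this (mul_pos hNpos hNpos)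
    change (0 : ℝ) ≤ μ
    nlinarith
  have h3 := hP.dotProduct_mulVec_nonneg (fun i => (h i : ℂ) * x i)
  have e3 : E *ᵥ (fun i => (h i : ℂ) * x i) = x := by
    ext i
    have hne : (h i : ℂ) ≠ 0 := by exact_mod_cast (hpos i).ne'
    simp [hE, mulVec_diagonal, hne]
  rw [sub_mulVec, one_mulVec, ← mulVec_mulVec, ← mulVec_mulVec, e3, dotProduct_sub,
    dotProduct_mulVec _ E] at h3
  have e4 : star (fun i => (h i : ℂ) * x i) ᵥ* E = star x := by
    rw [← hEh, ← star_mulVec, e3]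
  have e5 : star (fun i => (h i : ℂ) * x i) ⬝ᵥ (fun i => (h i : ℂ) * x i) =
      ((∑ i, √(a i * b i) * ‖x i‖ ^ 2 : ℝ) : ℂ) := by
    push_cast
    refine Finset.sum_congr rfl fun i _ => ?_
    rw [← hsq]
    have : star (x i) * x i = (‖x i‖ : ℂ) ^ 2 := by
      simpa using Complex.conj_mul' (x i)
    simp only [Pi.star_apply, star_mul', Complex.star_def, Complex.conj_ofReal] at this ⊢
    push_cast
    linear_combination (h i * h i : ℂ) * this
  rw [e4, e5] at h3
  have := (Complex.le_def.1 h3).1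
  simp only [Complex.zero_re, Complex.sub_re, Complex.ofReal_re] at this
  linarith

/-- A Hermitian form dominated by the geometric mean of two diagonal forms in the Cauchy-Schwarz
sense is dominated by it as a quadratic form. -/
theorem re_form_le {ι : Type*} [Fintype ι] [DecidableEq ι] {a b : ι → ℝ}
    (ha : ∀ i, 0 ≤ a i) (hb : ∀ i, 0 ≤ b i) {T : Matrix ι ι ℂ} (hT : T.IsHermitian)
    (hCS : ∀ x y : ι → ℂ, ‖star x ⬝ᵥ T *ᵥ y‖ ^ 2 ≤
      (∑ i, a i * ‖x i‖ ^ 2) * ∑ i, b i * ‖y i‖ ^ 2) (x : ι → ℂ) :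
    (star x ⬝ᵥ T *ᵥ x).re ≤ ∑ i, √(a i * b i) * ‖x i‖ ^ 2 := by
  -- Vanishing weights are reached by perturbing both weights by `ε` and letting `ε → 0⁺`.
  have hc : Continuous fun ε : ℝ => ∑ i, √((a i + ε) * (b i + ε)) * ‖x i‖ ^ 2 := by fun_prop
  have hlim := (hc.tendsto 0).mono_left (nhdsWithin_le_nhds (s := Set.Ioi 0))
  simp only [add_zero] at hlim
  refine ge_of_tendsto hlim (Filter.eventually_of_mem self_mem_nhdsWithin fun ε hε => ?_)
  have hε : 0 < ε := hε
  refine re_form_le_of_pos (fun i => add_pos_of_nonneg_of_pos (ha i) hε)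
    (fun i => add_pos_of_nonneg_of_pos (hb i) hε) hT (fun x y => (hCS x y).trans ?_) x
  have h1 : ∀ i, 0 ≤ a i * ‖x i‖ ^ 2 := fun i => mul_nonneg (ha i) (sq_nonneg _)
  have h2 : ∀ i, 0 ≤ b i * ‖y i‖ ^ 2 := fun i => mul_nonneg (hb i) (sq_nonneg _)
  gcongr with i _ i _
  · exact Finset.sum_nonneg fun i _ => h2 i
  · exact Finset.sum_nonneg fun i _ => mul_nonneg (add_nonneg (ha i) hε.le) (sq_nonneg _)
  · linarith
  · linarith

/-! ### Monotonicity of `tr (√R X† √R X)` under partial trace -/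

theorem norm_trace_conjTranspose_mul_sq_le {m n : Type*} [Fintype m] [Fintype n]
    (M N : Matrix m n ℂ) :
    ‖(Mᴴ * N).trace‖ ^ 2 ≤ (Mᴴ * M).trace.re * (Nᴴ * N).trace.re := by
  have e : ∀ M N : Matrix m n ℂ, (Mᴴ * N).trace = ∑ p : n × m, star (M p.2 p.1) * N p.2 p.1 := by
    intro M N
    simp [Matrix.trace, mul_apply, Fintype.sum_prod_type]
  have e' : ∀ M : Matrix m n ℂ, (Mᴴ * M).trace.re = ∑ p : n × m, ‖M p.2 p.1‖ ^ 2 := by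
    intro M
    rw [e, Complex.re_sum]
    refine Finset.sum_congr rfl fun p _ => ?_
    have : star (M p.2 p.1) * M p.2 p.1 = ((‖M p.2 p.1‖ ^ 2 : ℝ) : ℂ) := by
      simpa using Complex.conj_mul' (M p.2 p.1)
    rw [this, Complex.ofReal_re]
  rw [e, e', e']
  refine le_trans ?_ (Finset.sum_mul_sq_le_sq_mul_sq _ _ _)
  gcongr
  refine (norm_sum_le _ _).trans (le_of_eq ?_)
  simp

theorem trace_mul_kronecker_one {m n : Type*} [Fintype m] [Fintype n] [DecidableEq n]
    (M : Matrix (m × n) (m × n) ℂ) (X : Matrix m m ℂ) :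
    (M * (X ⊗ₖ (1 : Matrix n n ℂ))).trace = (traceB M * X).trace := by
  simp only [Matrix.trace, diag_apply, mul_apply, Fintype.sum_prod_type, kroneckerMap_apply,
    one_apply, mul_ite, mul_one, mul_zero, Finset.sum_ite_eq', Finset.mem_univ, if_true, traceB,
    of_apply, Finset.sum_mul]
  exact Finset.sum_congr rfl fun i _ => Finset.sum_comm

theorem traceB_kronecker_one_mul_mul {a a' b : Type*} [Fintype a] [Fintype b] [DecidableEq b]
    (X : Matrix a' a ℂ) (Y : Matrix a a' ℂ) (M : Matrix (a × b) (a × b) ℂ) :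
    traceB ((X ⊗ₖ (1 : Matrix b b ℂ)) * M * (Y ⊗ₖ (1 : Matrix b b ℂ))) = X * traceB M * Y := by
  ext i j
  simp only [traceB, of_apply, mul_apply, Fintype.sum_prod_type, kroneckerMap_apply, one_apply,
    mul_ite, mul_one, mul_zero, ite_mul, zero_mul, Finset.sum_ite_eq, Finset.sum_ite_eq',
    Finset.mem_univ, if_true, Finset.sum_mul, Finset.mul_sum]
  rw [Finset.sum_comm]
  refine Finset.sum_congr rfl fun x _ => ?_
  rw [Finset.sum_comm]

theorem trace_conjTranspose_mul_diagonal_mul {m : Type*} [Fintype m] [DecidableEq m]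
    (c d : m → ℝ) (Y : Matrix m m ℂ) :
    (diagonal (fun i => (c i : ℂ)) * Yᴴ * diagonal (fun i => (d i : ℂ)) * Y).trace.re =
      ∑ p : m × m, d p.1 * c p.2 * ‖Y p.1 p.2‖ ^ 2 := by
  rw [Fintype.sum_prod_type_right]
  simp only [Matrix.trace, diag_apply, Complex.re_sum]
  refine Finset.sum_congr rfl fun j _ => ?_
  rw [mul_apply, Complex.re_sum]
  refine Finset.sum_congr rfl fun i _ => ?_
  rw [mul_diagonal, diagonal_mul, conjTranspose_apply]
  have : star (Y i j) * Y i j = ((‖Y i j‖ ^ 2 : ℝ) : ℂ) := by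
    simpa using Complex.conj_mul' (Y i j)
  rw [show (c j : ℂ) * star (Y i j) * d i * Y i j = ((d i * c j : ℝ) : ℂ) * (star (Y i j) * Y i j)
    by push_cast; ring, this, ← Complex.ofReal_mul, Complex.ofReal_re]

/-- Hilbert–Schmidt Cauchy–Schwarz applied to `X S` and `S Y` bounds the form by `tr (S² X†X)` and
`tr (S² YY†)`. Both only see `traceB (S * S)`, hence are diagonal in the matrix entries, with
weights `l` of the column and of the row; `re_form_le` then takes their geometric mean. -/
theorem re_trace_le_of_traceB_eq_diagonal {n κ : Type*} [Fintype n] [DecidableEq n] [Fintype κ]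
    [DecidableEq κ] {S : Matrix (n × κ) (n × κ) ℂ} (hS : S.IsHermitian) {l : n → ℝ}
    (hl : ∀ i, 0 ≤ l i) (hσ : traceB (S * S) = diagonal fun i => (l i : ℂ)) (X : Matrix n n ℂ) :
    (S * (X ⊗ₖ (1 : Matrix κ κ ℂ))ᴴ * S * (X ⊗ₖ (1 : Matrix κ κ ℂ))).trace.re ≤
      ∑ p : n × n, √(l p.2 * l p.1) * ‖X p.1 p.2‖ ^ 2 := by
  set F : n × n → Matrix (n × κ) (n × κ) ℂ :=
    fun p => single p.1 p.2 (1 : ℂ) ⊗ₖ (1 : Matrix κ κ ℂ) with hF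
  set T : Matrix (n × n) (n × n) ℂ := of fun p q => (S * (F p)ᴴ * S * F q).trace with hTdef
  have hX : ∀ x : n × n → ℂ,
      (of fun i j => x (i, j)) ⊗ₖ (1 : Matrix κ κ ℂ) = ∑ p, x p • F p := by
    intro x
    ext ⟨i, k⟩ ⟨j, m⟩
    simp only [hF, Matrix.sum_apply, Matrix.smul_apply, kroneckerMap_apply, single_apply, of_apply,
      Fintype.sum_prod_type, ite_and, ite_mul, one_mul, zero_mul, smul_eq_mul, mul_ite, mul_zero,
      Finset.sum_ite_eq', Finset.mem_univ, if_true, Finset.sum_ite_irrel, Finset.sum_const_zero]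
  have hform : ∀ x y : n × n → ℂ, star x ⬝ᵥ T *ᵥ y =
      (S * ((of fun i j => x (i, j)) ⊗ₖ (1 : Matrix κ κ ℂ))ᴴ * S *
        ((of fun i j => y (i, j)) ⊗ₖ (1 : Matrix κ κ ℂ))).trace := by
    intro x y
    rw [hX, hX]
    simp only [conjTranspose_sum, conjTranspose_smul, Matrix.sum_mul, trace_sum,
      Matrix.mul_smul, Matrix.smul_mul, trace_smul, dotProduct, mulVec, Finset.mul_sum, hTdef, of_apply,
      smul_eq_mul, Pi.star_apply]
    rw [Finset.sum_comm]
    refine Finset.sum_congr rfl fun q _ => Finset.sum_congr rfl fun p _ => by ring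
  have hT : T.IsHermitian := by
    ext p q
    simp only [hTdef, conjTranspose_apply, of_apply]
    rw [← trace_conjTranspose]
    simp only [conjTranspose_mul, conjTranspose_conjTranspose, hS.eq]
    rw [← mul_assoc, ← mul_assoc, trace_mul_comm, ← mul_assoc, ← mul_assoc]
  have hCS : ∀ x y : n × n → ℂ, ‖star x ⬝ᵥ T *ᵥ y‖ ^ 2 ≤
      (∑ p, l p.2 * ‖x p‖ ^ 2) * ∑ p, l p.1 * ‖y p‖ ^ 2 := by
    intro x y
    rw [hform]
    set Xk := (of fun i j => x (i, j)) ⊗ₖ (1 : Matrix κ κ ℂ) with hXk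
    set Yk := (of fun i j => y (i, j)) ⊗ₖ (1 : Matrix κ κ ℂ) with hYk
    have h := norm_trace_conjTranspose_mul_sq_le (Xk * S) (S * Yk)
    have e0 : (Xk * S)ᴴ * (S * Yk) = S * Xkᴴ * S * Yk := by
      rw [conjTranspose_mul, hS.eq]; simp only [mul_assoc]
    have e1 : ((Xk * S)ᴴ * (Xk * S)).trace.re = ∑ p, l p.2 * ‖x p‖ ^ 2 := by
      have : ((Xk * S)ᴴ * (Xk * S)).trace = (S * S * (Xkᴴ * Xk)).trace := by
        rw [conjTranspose_mul, hS.eq, ← mul_assoc, trace_mul_comm]; simp only [mul_assoc]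
      rw [this, hXk, conjTranspose_kronecker, ← mul_kronecker_mul, conjTranspose_one, mul_one,
        trace_mul_kronecker_one, hσ, ← mul_assoc]
      have h2 := trace_conjTranspose_mul_diagonal_mul l (fun _ => 1) (of fun i j => x (i, j))
      simpa using h2
    have e2 : ((S * Yk)ᴴ * (S * Yk)).trace.re = ∑ p, l p.1 * ‖y p‖ ^ 2 := by
      have : ((S * Yk)ᴴ * (S * Yk)).trace = (S * S * (Yk * Ykᴴ)).trace := by
        rw [conjTranspose_mul, hS.eq, mul_assoc, trace_mul_comm]; simp only [mul_assoc]
      rw [this, hYk, conjTranspose_kronecker, ← mul_kronecker_mul, conjTranspose_one, mul_one,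
        trace_mul_kronecker_one, hσ, ← mul_assoc, trace_mul_comm, ← mul_assoc]
      have h2 := trace_conjTranspose_mul_diagonal_mul (fun _ => 1) l (of fun i j => y (i, j))
      simpa using h2
    rwa [e0, e1, e2] at h
  have h := re_form_le (fun p => hl p.2) (fun p => hl p.1) hT hCS fun p => X p.1 p.2
  rw [hform] at h
  exact h

theorem sqrt_conj {m n : Type*} [Fintype m] [DecidableEq m] [Fintype n] [DecidableEq n]
    {ρ : Matrix m m ℂ} (hρ : ρ.PosSemidef) {V : Matrix n m ℂ} (hV : Vᴴ * V = 1) :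
    CFC.sqrt (V * ρ * Vᴴ) = V * CFC.sqrt ρ * Vᴴ := by
  rw [CFC.sqrt_eq_iff _ _ (hρ.mul_mul_conjTranspose_same V).nonneg
    ((CFC.sqrt_nonneg ρ).posSemidef.mul_mul_conjTranspose_same V).nonneg]
  calc V * CFC.sqrt ρ * Vᴴ * (V * CFC.sqrt ρ * Vᴴ)
      = V * CFC.sqrt ρ * (Vᴴ * V) * CFC.sqrt ρ * Vᴴ := by simp only [Matrix.mul_assoc]
    _ = V * (CFC.sqrt ρ * CFC.sqrt ρ) * Vᴴ := by rw [hV, Matrix.mul_one]; simp only [Matrix.mul_assoc]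
    _ = V * ρ * Vᴴ := by rw [CFC.sqrt_mul_sqrt_self ρ hρ.nonneg]

theorem sqrt_diagonal {n : Type*} [Fintype n] [DecidableEq n] {l : n → ℝ} (hl : ∀ i, 0 ≤ l i) :
    CFC.sqrt (diagonal fun i => (l i : ℂ)) = diagonal fun i => ((√(l i) : ℝ) : ℂ) := by
  have hp : ∀ {c : n → ℝ}, (∀ i, 0 ≤ c i) → (diagonal fun i => (c i : ℂ)).PosSemidef :=
    fun hc => PosSemidef.diagonal fun i => Complex.zero_le_real.2 (hc i)
  rw [CFC.sqrt_eq_iff _ _ (hp hl).nonneg (hp fun i => Real.sqrt_nonneg _).nonneg,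
    diagonal_mul_diagonal]
  congr 1
  ext i
  rw [← Complex.ofReal_mul, Real.mul_self_sqrt (hl i)]

/-- Monotonicity under the partial trace of the form `X ↦ tr (√ρ X† √ρ X)`. -/
theorem re_trace_sqrt_le_traceB {n κ : Type*} [Fintype n] [DecidableEq n] [Fintype κ]
    [DecidableEq κ] {R : Matrix (n × κ) (n × κ) ℂ} (hR : R.PosSemidef)
    (hσ : (traceB R).PosSemidef) (X : Matrix n n ℂ) :
    (CFC.sqrt R * (X ⊗ₖ (1 : Matrix κ κ ℂ))ᴴ * CFC.sqrt R *
        (X ⊗ₖ (1 : Matrix κ κ ℂ))).trace.re ≤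
      (CFC.sqrt (traceB R) * Xᴴ * CFC.sqrt (traceB R) * X).trace.re := by
  set S := CFC.sqrt R
  have hS : S.IsHermitian := (CFC.sqrt_nonneg R).posSemidef.1
  have hSS : S * S = R := CFC.sqrt_mul_sqrt_self R hR.nonneg
  set U : Matrix n n ℂ := (hσ.1.eigenvectorUnitary : Matrix n n ℂ) with hU
  set l := hσ.1.eigenvalues
  have hl : ∀ i, 0 ≤ l i := hσ.eigenvalues_nonneg
  have hUU : Uᴴ * U = 1 := Unitary.coe_star_mul_self hσ.1.eigenvectorUnitary
  have hUU' : U * Uᴴ = 1 := Unitary.coe_mul_star_self hσ.1.eigenvectorUnitary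
  have hspec : traceB R = U * diagonal (fun i => (l i : ℂ)) * Uᴴ := hσ.1.spectral_theorem
  have hdiag : Uᴴ * traceB R * U = diagonal fun i => (l i : ℂ) := by
    rw [hspec]
    calc Uᴴ * (U * diagonal (fun i => (l i : ℂ)) * Uᴴ) * U
        = (Uᴴ * U) * diagonal (fun i => (l i : ℂ)) * (Uᴴ * U) := by simp only [mul_assoc]
      _ = _ := by rw [hUU, one_mul, mul_one]
  set D : Matrix n n ℂ := diagonal fun i => ((√(l i) : ℝ) : ℂ)
  have hsq : CFC.sqrt (traceB R) = U * D * Uᴴ := by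
    rw [hspec, sqrt_conj (PosSemidef.diagonal fun i => Complex.zero_le_real.2 (hl i)) hUU,
      sqrt_diagonal hl]
  set W := U ⊗ₖ (1 : Matrix κ κ ℂ) with hW
  have hWh : Wᴴ = Uᴴ ⊗ₖ (1 : Matrix κ κ ℂ) := by
    rw [hW, conjTranspose_kronecker, conjTranspose_one]
  have hWW' : W * Wᴴ = 1 := by
    rw [hWh, hW, ← mul_kronecker_mul, hUU', mul_one, one_kronecker_one]
  have hS' : (Wᴴ * S * W).IsHermitian := by
    simp only [IsHermitian, conjTranspose_mul, conjTranspose_conjTranspose, hS.eq, mul_assoc]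
  have hSS' : traceB (Wᴴ * S * W * (Wᴴ * S * W)) = diagonal fun i => (l i : ℂ) := by
    rw [show Wᴴ * S * W * (Wᴴ * S * W) = Wᴴ * S * (W * Wᴴ) * S * W by simp only [mul_assoc],
      hWW', mul_one, mul_assoc Wᴴ, hSS, hWh, hW, traceB_kronecker_one_mul_mul, hdiag]
  -- Everything is conjugated by `U ⊗ 1`, with `U` diagonalising `traceB R`, to reach the diagonal
  -- case.
  have h := re_trace_le_of_traceB_eq_diagonal hS' hl hSS' (Uᴴ * X * U)
  have hXk : (Uᴴ * X * U) ⊗ₖ (1 : Matrix κ κ ℂ) = Wᴴ * (X ⊗ₖ (1 : Matrix κ κ ℂ)) * W := by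
    rw [hWh, hW, ← mul_kronecker_mul, ← mul_kronecker_mul, mul_one, mul_one]
  set Xk := X ⊗ₖ (1 : Matrix κ κ ℂ)
  have e1 : (Wᴴ * S * W * (Wᴴ * Xk * W)ᴴ * (Wᴴ * S * W) * (Wᴴ * Xk * W)).trace =
      (S * Xkᴴ * S * Xk).trace := by
    calc _ = (Wᴴ * (S * (W * Wᴴ) * Xkᴴ * (W * Wᴴ) * S * (W * Wᴴ) * Xk * W)).trace := by
          simp only [conjTranspose_mul, conjTranspose_conjTranspose, mul_assoc]
      _ = (S * Xkᴴ * S * Xk * (W * Wᴴ)).trace := by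
          rw [trace_mul_comm]; simp only [hWW', mul_one, mul_assoc]
      _ = _ := by rw [hWW', mul_one]
  have e2 : (CFC.sqrt (traceB R) * Xᴴ * CFC.sqrt (traceB R) * X).trace =
      (D * (Uᴴ * X * U)ᴴ * D * (Uᴴ * X * U)).trace := by
    rw [hsq]
    calc _ = (U * (D * Uᴴ * Xᴴ * U * D * Uᴴ * X)).trace := by simp only [mul_assoc]
      _ = _ := by
        rw [trace_mul_comm]
        simp only [conjTranspose_mul, conjTranspose_conjTranspose, mul_assoc]
  rw [hXk, e1] at h
  rw [e2, trace_conjTranspose_mul_diagonal_mul]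
  refine h.trans (le_of_eq (Finset.sum_congr rfl fun p _ => ?_))
  rw [Real.sqrt_mul (hl _), mul_comm (√(l p.2))]

/-! ### Summing the form over a family of operators -/

/-- The hypothesis is `∑ X ⊗ Y = α 1 + swap` in coordinates: the identity term yields `tr S²` and
the swap term `tr (tr_A S)²`. It is used with `α = 1` for the 2-design and with `α = 0` for matrix
units. -/
theorem sum_trace_eq {ι a b : Type*} [Fintype ι] [Fintype a] [DecidableEq a] [Fintype b]
    [DecidableEq b] (S : Matrix (a × b) (a × b) ℂ) (X Y : ι → Matrix a a ℂ) (α : ℂ)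
    (h : ∀ i j k l, ∑ t, X t i j * Y t k l =
      α * (if i = j ∧ k = l then 1 else 0) + if i = l ∧ j = k then 1 else 0) :
    ∑ t, (S * (X t ⊗ₖ (1 : Matrix b b ℂ)) * S * (Y t ⊗ₖ (1 : Matrix b b ℂ))).trace =
      α * (S * S).trace + (traceA S * traceA S).trace := by
  have e : ∀ t, (S * (X t ⊗ₖ (1 : Matrix b b ℂ)) * S * (Y t ⊗ₖ (1 : Matrix b b ℂ))).trace =
      ∑ l, ∑ v, ∑ j, ∑ u, ∑ i, ∑ k, (X t i j * Y t k l) * (S (l, v) (i, u) * S (j, u) (k, v)) := by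
    intro t
    rw [Matrix.mul_assoc (S * _)]
    simp only [Matrix.trace, diag_apply]
    rw [Fintype.sum_prod_type]
    refine Finset.sum_congr rfl fun l _ => Finset.sum_congr rfl fun v _ => ?_
    rw [mul_apply, Fintype.sum_prod_type]
    refine Finset.sum_congr rfl fun j _ => Finset.sum_congr rfl fun u _ => ?_
    have e1 : (S * (X t ⊗ₖ (1 : Matrix b b ℂ))) (l, v) (j, u) = ∑ i, S (l, v) (i, u) * X t i j := by
      simp [mul_apply, Fintype.sum_prod_type, one_apply]
    have e2 : (S * (Y t ⊗ₖ (1 : Matrix b b ℂ))) (j, u) (l, v) = ∑ k, S (j, u) (k, v) * Y t k l := by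
      simp [mul_apply, Fintype.sum_prod_type, one_apply]
    rw [e1, e2, Finset.sum_mul_sum]
    exact Finset.sum_congr rfl fun i _ => Finset.sum_congr rfl fun k _ => by ring
  have e' : ∑ t, (S * (X t ⊗ₖ (1 : Matrix b b ℂ)) * S * (Y t ⊗ₖ (1 : Matrix b b ℂ))).trace =
      ∑ l, ∑ v, ∑ j, ∑ u, ∑ i, ∑ k, (α * (if i = j ∧ k = l then 1 else 0) +
        if i = l ∧ j = k then 1 else 0) * (S (l, v) (i, u) * S (j, u) (k, v)) := by
    simp only [e, ← h, Finset.sum_mul]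
    rw [Finset.sum_comm]; refine Finset.sum_congr rfl fun l _ => ?_
    rw [Finset.sum_comm]; refine Finset.sum_congr rfl fun v _ => ?_
    rw [Finset.sum_comm]; refine Finset.sum_congr rfl fun j _ => ?_
    rw [Finset.sum_comm]; refine Finset.sum_congr rfl fun u _ => ?_
    rw [Finset.sum_comm]; refine Finset.sum_congr rfl fun i _ => ?_
    rw [Finset.sum_comm]
  have e1 : (S * S).trace = ∑ l, ∑ v, ∑ j, ∑ u, S (l, v) (j, u) * S (j, u) (l, v) := by
    simp [Matrix.trace, mul_apply, Fintype.sum_prod_type]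
  have e2 : (traceA S * traceA S).trace =
      ∑ l, ∑ v, ∑ j, ∑ u, S (l, v) (l, u) * S (j, u) (j, v) := by
    simp only [Matrix.trace, mul_apply, diag_apply, traceA, of_apply, Finset.sum_mul_sum]
    rw [Finset.sum_comm' (t' := Finset.univ) (s' := fun _ => Finset.univ) (by simp)]
    simp only [Finset.sum_comm (s := (Finset.univ : Finset a)) (t := (Finset.univ : Finset b))]
    exact Finset.sum_comm
  rw [e', e1, e2]
  simp only [add_mul, Finset.sum_add_distrib, ite_and, mul_ite, mul_one, mul_zero, ite_mul,
    one_mul, zero_mul, Finset.sum_ite_eq, Finset.sum_ite_eq', Finset.mem_univ, if_true,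
    Finset.sum_ite_irrel, Finset.sum_const_zero, Finset.mul_sum]

/-! ### Complete MUB sets as projective 2-designs -/

theorem ketbra_apply_eq {d : ℕ} (P : ONB d) (i j : Fin d) :
    (∑ m, ketbra (P m)) i j = (1 : Matrix (Fin d) (Fin d) ℂ) i j := by
  have h := P.sum_inner_mul_inner (EuclideanSpace.single i (1 : ℂ)) (EuclideanSpace.single j 1)
  simp only [EuclideanSpace.inner_single_left, EuclideanSpace.inner_single_right, map_one,
    one_mul] at h
  rw [Matrix.sum_apply]
  simpa [ketbra, one_apply, Pi.single_apply, eq_comm] using h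

theorem sum_ketbra {d : ℕ} (P : ONB d) : ∑ m, ketbra (P m) = 1 := by
  ext i j
  exact ketbra_apply_eq P i j

theorem trace_ketbra_mul {d : ℕ} (v w : EuclideanSpace ℂ (Fin d)) :
    (ketbra v * ketbra w).trace = ((‖inner ℂ v w‖ ^ 2 : ℝ) : ℂ) := by
  have h : (inner ℂ v w : ℂ) = ∑ i, w i * star (v i) := by
    simp [PiLp.inner_apply]
  have h2 := Complex.mul_conj' (inner ℂ v w : ℂ)
  push_cast
  rw [← h2, h, map_sum, Finset.sum_mul_sum]
  simp only [Matrix.trace, diag_apply, mul_apply, ketbra, of_apply]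
  rw [Finset.sum_comm]
  refine Finset.sum_congr rfl fun i _ => Finset.sum_congr rfl fun j _ => ?_
  simp
  ring

theorem trace_ketbra {d : ℕ} (v : EuclideanSpace ℂ (Fin d)) (hv : ‖v‖ = 1) :
    (ketbra v).trace = 1 := by
  have h := inner_self_eq_norm_sq_to_K (𝕜 := ℂ) v
  have e : (ketbra v).trace = inner ℂ v v := by
    rw [PiLp.inner_apply]
    simp only [Matrix.trace, ketbra, diag_apply, of_apply]
    rfl
  rw [e, h, hv]
  simp

theorem ketbra_mul_self {d : ℕ} (v : EuclideanSpace ℂ (Fin d)) (hv : ‖v‖ = 1) :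
    ketbra v * ketbra v = ketbra v := by
  have h := trace_ketbra v hv
  simp only [Matrix.trace, diag_apply, ketbra, of_apply] at h
  ext i j
  simp only [mul_apply, ketbra, of_apply]
  calc ∑ k, v i * star (v k) * (v k * star (v j))
      = v i * star (v j) * ∑ k, v k * star (v k) := by
        rw [Finset.mul_sum]; exact Finset.sum_congr rfl fun k _ => by ring
    _ = _ := by rw [h, mul_one]

/-- The operator exchanging the two tensor factors. -/
def swapMatrix (a : Type*) [DecidableEq a] : Matrix (a × a) (a × a) ℂ :=
  of fun p q => if p = q.swap then 1 else 0

theorem swapMatrix_isHermitian (a : Type*) [DecidableEq a] : (swapMatrix a).IsHermitian := by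
  ext ⟨i, k⟩ ⟨j, l⟩
  simp only [swapMatrix, conjTranspose_apply, of_apply, Prod.swap_prod_mk, Prod.mk.injEq,
    RCLike.star_def, apply_ite (starRingEnd ℂ), map_one, map_zero]
  congr 1
  simp only [eq_iff_iff]
  constructor <;> rintro ⟨rfl, rfl⟩ <;> simp

theorem mul_swapMatrix_apply {a : Type*} [Fintype a] [DecidableEq a]
    (M : Matrix (a × a) (a × a) ℂ) (p q : a × a) : (M * swapMatrix a) p q = M p q.swap := by
  simp [swapMatrix, mul_apply]

theorem trace_kronecker_mul_swapMatrix {a : Type*} [Fintype a] [DecidableEq a]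
    (X Y : Matrix a a ℂ) : ((X ⊗ₖ Y) * swapMatrix a).trace = (X * Y).trace := by
  simp only [Matrix.trace, diag_apply, mul_swapMatrix_apply, kroneckerMap_apply, Prod.fst_swap,
    Prod.snd_swap, Fintype.sum_prod_type]
  simp only [mul_apply]

/-- The vector's own basis contributes `1`. Each of the `d` other bases contributes `d` terms
`1/d²`, which adds up to another `1`. -/
theorem sum_trace_ketbra_mul_sq {d : ℕ} {B : Fin (d + 1) → ONB d} (hB : IsCompleteMUB B)
    (t : Fin (d + 1)) (m : Fin d) :
    ∑ q : Fin (d + 1) × Fin d, (ketbra (B t m) * ketbra (B q.1 q.2)).trace ^ 2 = 2 := by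
  have hd : (d : ℂ) ≠ 0 := by exact_mod_cast m.pos.ne'
  rw [Fintype.sum_prod_type]
  have h : ∀ s, ∑ m', (ketbra (B t m) * ketbra (B s m')).trace ^ 2 =
      1 / (d : ℂ) + if t = s then 1 - 1 / (d : ℂ) else 0 := by
    intro s
    split_ifs with hs
    · subst hs
      simp only [trace_ketbra_mul, orthonormal_iff_ite.1 (B t).orthonormal]
      rw [Finset.sum_eq_single m]
      · simp
      · intro b _ hb; simp [hb.symm]
      · simp
    · have : ∀ m', (ketbra (B t m) * ketbra (B s m')).trace ^ 2 = (1 / (d : ℂ)) ^ 2 := by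
        intro m'
        rw [trace_ketbra_mul, hB t s hs m m', div_pow, Real.sq_sqrt (Nat.cast_nonneg d)]
        simp
      simp only [this, Finset.sum_const, Finset.card_univ, Fintype.card_fin, nsmul_eq_mul]
      field_simp
      simp
  simp only [h, Finset.sum_add_distrib, Finset.sum_const, Finset.card_univ, Fintype.card_fin,
    nsmul_eq_mul, Finset.sum_ite_eq, Finset.mem_univ, if_true]
  push_cast
  field_simp
  ring

/-- A complete set of mutually unbiased bases is a projective 2-design. -/
theorem IsCompleteMUB.sum_kronecker {d : ℕ} {B : Fin (d + 1) → ONB d} (hB : IsCompleteMUB B) :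
    ∑ q : Fin (d + 1) × Fin d, ketbra (B q.1 q.2) ⊗ₖ ketbra (B q.1 q.2) =
      1 + swapMatrix (Fin d) := by
  set p : Fin (d + 1) × Fin d → Matrix (Fin d) (Fin d) ℂ := fun q => ketbra (B q.1 q.2) with hp
  have hn : ∀ q : Fin (d + 1) × Fin d, ‖B q.1 q.2‖ = 1 := fun q => (B q.1).orthonormal.1 q.2
  set G := ∑ q, p q ⊗ₖ p q with hG
  set J : Matrix (Fin d × Fin d) (Fin d × Fin d) ℂ := 1 + swapMatrix (Fin d) with hJ
  have hGh : Gᴴ = G := by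
    simp only [hG, hp, conjTranspose_sum, conjTranspose_kronecker, (ketbra_isHermitian _).eq]
  have hJh : Jᴴ = J := by
    rw [hJ, conjTranspose_add, conjTranspose_one, (swapMatrix_isHermitian _).eq]
  have hcard : ∑ _q : Fin (d + 1) × Fin d, (2 : ℂ) = 2 * ((d + 1) * d) := by
    simp [mul_comm]
  -- `G = J` because their Hilbert–Schmidt distance vanishes: `tr G²`, `tr GJ` and `tr J²` all equal
  -- `2 d (d + 1)`. The first two count `2` for each of the `d (d + 1)` basis vectors.
  have hGG : (G * G).trace = 2 * ((d + 1) * d) := by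
    rw [← hcard]
    simp only [hG, Matrix.sum_mul, Matrix.mul_sum, trace_sum, ← mul_kronecker_mul, trace_kronecker]
    rw [Finset.sum_comm]
    exact Finset.sum_congr rfl fun q _ => by
      simpa only [pow_two] using sum_trace_ketbra_mul_sq hB q.1 q.2
  have hGJ : (G * J).trace = 2 * ((d + 1) * d) := by
    rw [← hcard]
    simp only [hG, hJ, Matrix.sum_mul, Matrix.mul_add, Matrix.mul_one, trace_sum, trace_add,
      trace_kronecker, trace_kronecker_mul_swapMatrix]
    rw [← Finset.sum_add_distrib]
    refine Finset.sum_congr rfl fun q _ => ?_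
    simp only [hp, ketbra_mul_self _ (hn q), trace_ketbra _ (hn q)]
    norm_num
  have hW : (swapMatrix (Fin d)).trace = d := by
    have := trace_kronecker_mul_swapMatrix (1 : Matrix (Fin d) (Fin d) ℂ) 1
    simpa using this
  have hWW : swapMatrix (Fin d) * swapMatrix (Fin d) = 1 := by
    ext p q
    rw [mul_swapMatrix_apply]
    simp [swapMatrix, one_apply]
  have hJJ : (J * J).trace = 2 * ((d + 1) * d) := by
    rw [hJ, add_mul, mul_add, mul_add, hWW]
    simp only [one_mul, mul_one, trace_add, hW, trace_one, Fintype.card_prod, Fintype.card_fin]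
    push_cast
    ring
  have h0 : ((G - J)ᴴ * (G - J)).trace = 0 := by
    rw [conjTranspose_sub, hGh, hJh, sub_mul, mul_sub, mul_sub]
    simp only [trace_sub]
    rw [trace_mul_comm J G, hGG, hGJ, hJJ]
    ring
  exact sub_eq_zero.1 (trace_conjTranspose_mul_self_eq_zero_iff.1 h0)

/-! ### The closed form -/

theorem coe_skewInfo_of_mul_self {n : Type*} [Fintype n] [DecidableEq n] {ρ K : Matrix n n ℂ}
    (hρ : ρ.PosSemidef) (hK : K.IsHermitian) (hKK : K * K = K) :
    (skewInfo ρ K : ℂ) = (ρ * K).trace - (CFC.sqrt ρ * K * CFC.sqrt ρ * K).trace := by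
  rw [coe_skewInfo _ _ hK]
  have hSS : CFC.sqrt ρ * CFC.sqrt ρ = ρ := CFC.sqrt_mul_sqrt_self ρ hρ.nonneg
  set S := CFC.sqrt ρ
  have e : (S * K - K * S) ^ 2 = S * K * S * K - S * (K * K) * S - K * (S * S) * K
      + K * (S * K * S) := by noncomm_ring
  rw [e, hKK, hSS]
  simp only [trace_add, trace_sub]
  rw [trace_mul_comm K (S * K * S), trace_mul_comm (S * K) S, ← mul_assoc, hSS,
    trace_mul_comm (K * ρ) K, ← mul_assoc, hKK, trace_mul_comm K ρ]
  ring

/-- The linear parts `tr ρK` sum to `1` over each basis, hence to `dA + 1`; by the 2-design property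
the quadratic parts sum to `1 + tr (tr_A √ρ)²`. -/
theorem sum_partialCoherence {dA dB : ℕ} {B : Fin (dA + 1) → ONB dA} (hB : IsCompleteMUB B)
    {ρ : Matrix (Fin dA × Fin dB) (Fin dA × Fin dB) ℂ} (hρ : IsState ρ) :
    ((∑ t, partialCoherence ρ (B t) : ℝ) : ℂ) =
      dA - (traceA (CFC.sqrt ρ) * traceA (CFC.sqrt ρ)).trace := by
  have hn : ∀ t m, ‖B t m‖ = 1 := fun t m => (B t).orthonormal.1 m
  have h1 : ∀ t m, (skewInfo ρ (ketbra (B t m) ⊗ₖ (1 : Matrix (Fin dB) (Fin dB) ℂ)) : ℂ) =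
      (ρ * (ketbra (B t m) ⊗ₖ (1 : Matrix (Fin dB) (Fin dB) ℂ))).trace -
      (CFC.sqrt ρ * (ketbra (B t m) ⊗ₖ (1 : Matrix (Fin dB) (Fin dB) ℂ)) * CFC.sqrt ρ *
        (ketbra (B t m) ⊗ₖ (1 : Matrix (Fin dB) (Fin dB) ℂ))).trace := fun t m =>
    coe_skewInfo_of_mul_self hρ.1
      (by rw [IsHermitian, conjTranspose_kronecker, (ketbra_isHermitian _).eq, conjTranspose_one])
      (by rw [← mul_kronecker_mul, ketbra_mul_self _ (hn t m), mul_one])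
  have h2 : ∀ t, ∑ m, (ρ * (ketbra (B t m) ⊗ₖ (1 : Matrix (Fin dB) (Fin dB) ℂ))).trace = 1 := by
    intro t
    simp only [trace_mul_kronecker_one]
    rw [← trace_sum, ← Matrix.mul_sum, sum_ketbra, mul_one, hρ.traceB.2]
  have h3 := sum_trace_eq (CFC.sqrt ρ) (fun q : Fin (dA + 1) × Fin dA => ketbra (B q.1 q.2))
    (fun q => ketbra (B q.1 q.2)) 1 fun i j k l => by
      have h := congrFun (congrFun hB.sum_kronecker (i, k)) (j, l)
      rw [Matrix.sum_apply] at h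
      simpa only [kroneckerMap_apply, Matrix.add_apply, one_apply, swapMatrix, of_apply,
        Prod.swap_prod_mk, Prod.mk.injEq, one_mul, eq_comm (a := k) (b := j)] using h
  rw [Fintype.sum_prod_type, CFC.sqrt_mul_sqrt_self ρ hρ.1.nonneg, hρ.2] at h3
  simp only [partialCoherence]
  push_cast
  simp only [h1, Finset.sum_sub_distrib, h2, h3]
  simp
  ring

theorem isState_kronecker {m n : Type*} [Fintype m] [Fintype n]
    {σ : Matrix m m ℂ} {τ : Matrix n n ℂ} (hσ : IsState σ) (hτ : IsState τ) :
    IsState (σ ⊗ₖ τ) :=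
  ⟨hσ.1.kronecker hτ.1, by rw [trace_kronecker, hσ.2, hτ.2, mul_one]⟩

theorem traceA_kronecker {m n : Type*} [Fintype m] (X : Matrix m m ℂ) (Y : Matrix n n ℂ) :
    traceA (X ⊗ₖ Y) = X.trace • Y := by
  ext k l
  simp [traceA, Matrix.trace, Finset.sum_mul]

/-- Here `tr_A (√σ ⊗ √τ) = (tr √σ) √τ`, whose square has trace `(tr √σ)² tr τ`. -/
theorem trace_traceA_sqrt_kronecker {m n : Type*} [Fintype m] [DecidableEq m] [Fintype n]
    [DecidableEq n] {σ : Matrix m m ℂ} {τ : Matrix n n ℂ} (hσ : IsState σ) (hτ : IsState τ) :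
    (traceA (CFC.sqrt (σ ⊗ₖ τ)) * traceA (CFC.sqrt (σ ⊗ₖ τ))).trace =
      (CFC.sqrt σ).trace ^ 2 := by
  rw [sqrt_kronecker hσ.1 hτ.1, traceA_kronecker, Matrix.smul_mul, Matrix.mul_smul, trace_smul,
    trace_smul, CFC.sqrt_mul_sqrt_self τ hτ.1.nonneg, hτ.2]
  simp [pow_two]

theorem coe_Qmub {dA dB : ℕ} {B : Fin (dA + 1) → ONB dA} (hB : IsCompleteMUB B)
    {ρ : Matrix (Fin dA × Fin dB) (Fin dA × Fin dB) ℂ} (hρ : IsState ρ) :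
    (Qmub B ρ : ℂ) =
      ((CFC.sqrt (traceB ρ)).trace ^ 2 - (traceA (CFC.sqrt ρ) ^ 2).trace) / ((dA : ℂ) + 1) := by
  have h1 := sum_partialCoherence hB hρ
  have h2 := sum_partialCoherence hB (isState_kronecker hρ.traceB hρ.traceA)
  rw [trace_traceA_sqrt_kronecker hρ.traceB hρ.traceA] at h2
  simp only [Qmub, correlation, Finset.sum_sub_distrib]
  rw [Complex.ofReal_mul, Complex.ofReal_sub, h1, h2]
  push_cast
  rw [pow_two (traceA _)]
  ring

/-! ### Partial traces under local operations -/

theorem traceA_one_kronecker_mul_mul {a b b' : Type*} [Fintype a] [DecidableEq a] [Fintype b]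
    (X : Matrix b' b ℂ) (Y : Matrix b b' ℂ) (M : Matrix (a × b) (a × b) ℂ) :
    traceA (((1 : Matrix a a ℂ) ⊗ₖ X) * M * ((1 : Matrix a a ℂ) ⊗ₖ Y)) = X * traceA M * Y := by
  ext k l
  simp only [traceA, of_apply, mul_apply, Fintype.sum_prod_type, kroneckerMap_apply, one_apply,
    mul_ite, mul_zero, ite_mul, zero_mul, one_mul, Finset.sum_ite_irrel, Finset.sum_const_zero,
    Finset.sum_ite_eq, Finset.sum_ite_eq', Finset.mem_univ, if_true, Finset.sum_mul,
    Finset.mul_sum]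
  rw [Finset.sum_comm]
  refine Finset.sum_congr rfl fun x _ => ?_
  rw [Finset.sum_comm]

theorem traceA_kronecker_one_mul_comm {a b : Type*} [Fintype a] [Fintype b] [DecidableEq b]
    (X : Matrix a a ℂ) (M : Matrix (a × b) (a × b) ℂ) :
    traceA ((X ⊗ₖ (1 : Matrix b b ℂ)) * M) = traceA (M * (X ⊗ₖ (1 : Matrix b b ℂ))) := by
  ext k l
  simp only [traceA, of_apply, mul_apply, Fintype.sum_prod_type, kroneckerMap_apply, one_apply,
    mul_ite, mul_one, mul_zero, ite_mul, zero_mul, Finset.sum_ite_eq, Finset.sum_ite_eq',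
    Finset.mem_univ, if_true]
  rw [Finset.sum_comm]
  exact Finset.sum_congr rfl fun i _ => Finset.sum_congr rfl fun j _ => mul_comm _ _

theorem traceB_one_kronecker_mul_comm {a b : Type*} [Fintype a] [Fintype b] [DecidableEq a]
    (Y : Matrix b b ℂ) (M : Matrix (a × b) (a × b) ℂ) :
    traceB (((1 : Matrix a a ℂ) ⊗ₖ Y) * M) = traceB (M * ((1 : Matrix a a ℂ) ⊗ₖ Y)) := by
  ext i j
  simp only [traceB, of_apply, mul_apply, Fintype.sum_prod_type, kroneckerMap_apply, one_apply,
    mul_ite, mul_zero, ite_mul, zero_mul, one_mul, Finset.sum_ite_irrel, Finset.sum_const_zero,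
    Finset.sum_ite_eq, Finset.sum_ite_eq', Finset.mem_univ, if_true]
  rw [Finset.sum_comm]
  exact Finset.sum_congr rfl fun i _ => Finset.sum_congr rfl fun j _ => mul_comm _ _

/-- Split `U ⊗ V` as `(1 ⊗ V)(U ⊗ 1)`: operators on `B` pull out of `tr_A`, while those on `A` may
be cycled inside it and cancel. -/
theorem traceA_kronecker_conj {a b : Type*} [Fintype a] [DecidableEq a] [Fintype b]
    [DecidableEq b] {U : Matrix a a ℂ} (hU : Uᴴ * U = 1) (V : Matrix b b ℂ)
    (M : Matrix (a × b) (a × b) ℂ) :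
    traceA ((U ⊗ₖ V) * M * (U ⊗ₖ V)ᴴ) = V * traceA M * Vᴴ := by
  have e1 : U ⊗ₖ V = (1 ⊗ₖ V) * (U ⊗ₖ 1) := by rw [← mul_kronecker_mul, one_mul, mul_one]
  have e2 : (U ⊗ₖ V)ᴴ = (Uᴴ ⊗ₖ 1) * (1 ⊗ₖ Vᴴ) := by
    rw [conjTranspose_kronecker, ← mul_kronecker_mul, one_mul, mul_one]
  rw [e1, ← e1, e2, e1, show (1 ⊗ₖ V) * (U ⊗ₖ 1) * M * ((Uᴴ ⊗ₖ 1) * (1 ⊗ₖ Vᴴ)) =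
    (1 ⊗ₖ V) * ((U ⊗ₖ 1) * (M * (Uᴴ ⊗ₖ 1))) * (1 ⊗ₖ Vᴴ) by simp only [mul_assoc],
    traceA_one_kronecker_mul_mul, traceA_kronecker_one_mul_comm, mul_assoc M, ← mul_kronecker_mul,
    hU, mul_one, one_kronecker_one, mul_one]

theorem traceB_kronecker_conj {a b : Type*} [Fintype a] [DecidableEq a] [Fintype b]
    [DecidableEq b] (U : Matrix a a ℂ) {V : Matrix b b ℂ} (hV : Vᴴ * V = 1)
    (M : Matrix (a × b) (a × b) ℂ) :
    traceB ((U ⊗ₖ V) * M * (U ⊗ₖ V)ᴴ) = U * traceB M * Uᴴ := by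
  have e1 : U ⊗ₖ V = (U ⊗ₖ 1) * (1 ⊗ₖ V) := by rw [← mul_kronecker_mul, one_mul, mul_one]
  have e2 : (U ⊗ₖ V)ᴴ = (1 ⊗ₖ Vᴴ) * (Uᴴ ⊗ₖ 1) := by
    rw [conjTranspose_kronecker, ← mul_kronecker_mul, one_mul, mul_one]
  rw [e2, e1, show (U ⊗ₖ 1) * (1 ⊗ₖ V) * M * ((1 ⊗ₖ Vᴴ) * (Uᴴ ⊗ₖ 1)) =
    (U ⊗ₖ 1) * ((1 ⊗ₖ V) * (M * (1 ⊗ₖ Vᴴ))) * (Uᴴ ⊗ₖ 1) by simp only [mul_assoc],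
    traceB_kronecker_one_mul_mul, traceB_one_kronecker_mul_comm, mul_assoc M, ← mul_kronecker_mul,
    hV, mul_one, one_kronecker_one, mul_one]

/-! ### Isometries, reindexing and Stinespring dilation -/

theorem trace_conj {m n : Type*} [Fintype m] [Fintype n] [DecidableEq m] {V : Matrix n m ℂ}
    (hV : Vᴴ * V = 1) (M : Matrix m m ℂ) : (V * M * Vᴴ).trace = M.trace := by
  rw [trace_mul_comm, ← Matrix.mul_assoc, hV, Matrix.one_mul]

theorem conj_mul_conj {m n : Type*} [Fintype m] [Fintype n] [DecidableEq m] {V : Matrix n m ℂ}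
    (hV : Vᴴ * V = 1) (M N : Matrix m m ℂ) :
    V * M * Vᴴ * (V * N * Vᴴ) = V * (M * N) * Vᴴ := by
  calc V * M * Vᴴ * (V * N * Vᴴ) = V * M * (Vᴴ * V) * N * Vᴴ := by simp only [Matrix.mul_assoc]
    _ = _ := by rw [hV, Matrix.mul_one]; simp only [Matrix.mul_assoc]

theorem trace_submatrix_equiv {m n : Type*} [Fintype m] [Fintype n] (e : m ≃ n)
    (M : Matrix n n ℂ) : (M.submatrix e e).trace = M.trace :=
  e.sum_comp fun i => M i i

theorem sqrt_submatrix_equiv {m n : Type*} [Fintype m] [DecidableEq m] [Fintype n] [DecidableEq n]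
    (e : m ≃ n) {M : Matrix n n ℂ} (hM : M.PosSemidef) :
    CFC.sqrt (M.submatrix e e) = (CFC.sqrt M).submatrix e e := by
  rw [CFC.sqrt_eq_iff _ _ (hM.submatrix e).nonneg
    ((CFC.sqrt_nonneg M).posSemidef.submatrix e).nonneg, submatrix_mul_equiv,
    CFC.sqrt_mul_sqrt_self M hM.nonneg]

/-- Stinespring dilation of a channel by an isometry. -/
theorem IsChannel.exists_isometry {dB : ℕ} {c : Type*} [Fintype c] [DecidableEq c]
    {Φ : Matrix (Fin dB) (Fin dB) ℂ →ₗ[ℂ] Matrix c c ℂ} (hΦ : IsChannel Φ) :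
    ∃ W : Matrix (c × (Fin dB × c)) (Fin dB) ℂ, Wᴴ * W = 1 ∧
      ∀ X, Φ X = traceB (W * X * Wᴴ) := by
  -- `v` is the unnormalised maximally entangled vector. Its image under `id ⊗ Φ` is the Choi
  -- matrix, and the rows of a factor `C` with `C†C` equal to it give Kraus operators, indexed by
  -- the environment `Fin dB × c`.
  set v : Fin dB × Fin dB → ℂ := fun p => if p.1 = p.2 then 1 else 0 with hv
  have hJ := hΦ.1 dB _ (posSemidef_vecMulVec_self_star v)
  obtain ⟨C, hC⟩ := CStarAlgebra.nonneg_iff_eq_star_mul_self.1 hJ.nonneg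
  have hC' : ∀ k l m m', Φ (single k l 1) m m' = ∑ r, star (C r (k, m)) * C r (l, m') := by
    intro k l m m'
    have h := congrFun (congrFun hC (k, m)) (l, m')
    simp only [star_eq_conjTranspose, mul_apply, conjTranspose_apply] at h
    have e : single k l (1 : ℂ) = of fun i j => vecMulVec v (star v) (k, i) (l, j) := by
      ext i j
      simp [vecMulVec_apply, hv, single_apply, ite_and]
      split_ifs <;> rfl
    rw [← h, e]
    rfl
  set W : Matrix (c × (Fin dB × c)) (Fin dB) ℂ := of fun q k => star (C q.2 (k, q.1)) with hW
  have hrep : ∀ X, Φ X = traceB (W * X * Wᴴ) := by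
    intro X
    have hX : Φ X = ∑ k, ∑ l, X k l • Φ (single k l 1) := by
      conv_lhs => rw [matrix_eq_sum_single X]
      simp only [map_sum]
      refine Finset.sum_congr rfl fun k _ => Finset.sum_congr rfl fun l _ => ?_
      rw [← map_smul, smul_single, smul_eq_mul, mul_one]
    ext m m'
    rw [hX]
    simp only [Matrix.sum_apply, Matrix.smul_apply, hC', smul_eq_mul, traceB, of_apply, mul_apply,
      hW, conjTranspose_apply, star_star, Finset.mul_sum, Finset.sum_mul]
    conv_rhs => rw [Finset.sum_comm]
    rw [Finset.sum_comm]
    refine Finset.sum_congr rfl fun l _ => ?_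
    rw [Finset.sum_comm]
    refine Finset.sum_congr rfl fun r _ => Finset.sum_congr rfl fun k _ => by ring
  refine ⟨W, ?_, hrep⟩
  ext i j
  have htr : ∀ M : Matrix (c × (Fin dB × c)) (c × (Fin dB × c)) ℂ,
      (traceB M).trace = M.trace := fun M => by
    simp [Matrix.trace, traceB, Fintype.sum_prod_type]
  -- Trace preservation on a matrix unit reads off the `(i, j)` entry of `W†W`.
  have h := hΦ.2 (single j i 1)
  rw [hrep, htr, trace_mul_comm, ← Matrix.mul_assoc, trace_mul_single, op_smul_eq_mul,
    mul_one] at h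
  rw [h, one_apply]
  split_ifs with hij
  · rw [hij, trace_single_eq_same]
  · exact trace_single_eq_of_ne _ _ _ (Ne.symm hij)

/-! ### Non-negativity and contractivity -/

theorem sum_trace_single {a b : Type*} [Fintype a] [DecidableEq a] [Fintype b] [DecidableEq b]
    (S : Matrix (a × b) (a × b) ℂ) :
    ∑ p : a × a, (S * (single p.1 p.2 (1 : ℂ) ⊗ₖ (1 : Matrix b b ℂ))ᴴ * S *
      (single p.1 p.2 (1 : ℂ) ⊗ₖ (1 : Matrix b b ℂ))).trace = (traceA S * traceA S).trace := by
  have h := sum_trace_eq S (fun p : a × a => (single p.1 p.2 (1 : ℂ))ᴴ)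
    (fun p => single p.1 p.2 (1 : ℂ)) 0 fun i j k l => by
      rw [Fintype.sum_eq_single (k, l)]
      · simp [single_apply, eq_comm, and_comm]
      · intro p hp
        have : ¬(p.1 = k ∧ p.2 = l) := fun h => hp (Prod.ext h.1 h.2)
        simp [single_apply, this]
  simpa only [conjTranspose_kronecker, conjTranspose_one, zero_mul, zero_add] using h

/-- `(tr M)²` is the matrix-unit sum of `tr (M X† M X)`, so both sides are such sums and
monotonicity under `tr_B` compares them term by term. -/
theorem re_trace_traceA_sqrt_sq_le {a b : Type*} [Fintype a] [DecidableEq a] [Fintype b]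
    [DecidableEq b] {ρ : Matrix (a × b) (a × b) ℂ} (hρ : IsState ρ) :
    (traceA (CFC.sqrt ρ) ^ 2).trace.re ≤ ((CFC.sqrt (traceB ρ)).trace ^ 2).re := by
  have h : ∀ M : Matrix a a ℂ, M.trace ^ 2 =
      ∑ p : a × a, (M * (single p.1 p.2 (1 : ℂ))ᴴ * M * single p.1 p.2 (1 : ℂ)).trace := by
    intro M
    rw [Fintype.sum_prod_type_right, pow_two, Matrix.trace, Finset.sum_mul_sum]
    refine Finset.sum_congr rfl fun i _ => Finset.sum_congr rfl fun j _ => ?_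
    rw [trace_mul_single, conjTranspose_single, star_one, op_smul_eq_mul, mul_one,
      Matrix.mul_assoc, mul_apply]
    simp [mul_apply, single_apply, ite_and]
  rw [pow_two, ← sum_trace_single, h, Complex.re_sum, Complex.re_sum]
  exact Finset.sum_le_sum fun p _ => re_trace_sqrt_le_traceB hρ.1 hρ.traceB.1 _

/-- Trace preservation on each block leaves the marginal on `A` fixed, so only the second term of
the closed form can change under the channel. -/
theorem IsChannel.isState_idTensor {dA dB : ℕ} {c : Type*} [Fintype c]
    {Φ : Matrix (Fin dB) (Fin dB) ℂ →ₗ[ℂ] Matrix c c ℂ} (hΦ : IsChannel Φ)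
    {ρ : Matrix (Fin dA × Fin dB) (Fin dA × Fin dB) ℂ} (hρ : IsState ρ) :
    IsState (idTensor Φ ρ) ∧ traceB (idTensor Φ ρ) = traceB ρ := by
  have h : traceB (idTensor Φ ρ) = traceB ρ := by
    ext i j
    simpa [traceB, idTensor, Matrix.trace] using hΦ.2 (of fun k l => ρ (i, k) (j, l))
  have htr : ∀ {b : Type _} [Fintype b] (M : Matrix (Fin dA × b) (Fin dA × b) ℂ),
      (traceB M).trace = M.trace := fun M => by
    simp [Matrix.trace, traceB, Fintype.sum_prod_type]
  refine ⟨⟨hΦ.1 dA ρ hρ.1, ?_⟩, h⟩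
  rw [← htr, h]
  exact hρ.traceB.2

/-- The quantity `tr (tr_A √ρ)²` does not decrease under channels on the second factor. -/
theorem IsChannel.re_trace_traceA_sqrt_sq_le {dA dB : ℕ} {c : Type*} [Fintype c] [DecidableEq c]
    {Φ : Matrix (Fin dB) (Fin dB) ℂ →ₗ[ℂ] Matrix c c ℂ} (hΦ : IsChannel Φ)
    {ρ : Matrix (Fin dA × Fin dB) (Fin dA × Fin dB) ℂ} (hρ : IsState ρ) :
    (traceA (CFC.sqrt ρ) ^ 2).trace.re ≤ (traceA (CFC.sqrt (idTensor Φ ρ)) ^ 2).trace.re := by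
  obtain ⟨W, hW, hrep⟩ := hΦ.exists_isometry
  set V : Matrix (Fin dA × (c × (Fin dB × c))) (Fin dA × Fin dB) ℂ :=
    (1 : Matrix (Fin dA) (Fin dA) ℂ) ⊗ₖ W with hVdef
  have hVh : Vᴴ = (1 : Matrix (Fin dA) (Fin dA) ℂ) ⊗ₖ Wᴴ := by
    rw [hVdef, conjTranspose_kronecker, conjTranspose_one]
  have hV : Vᴴ * V = 1 := by
    rw [hVh, hVdef, ← mul_kronecker_mul, hW, mul_one, one_kronecker_one]
  set R' := V * ρ * Vᴴ with hR'
  have hR'p : R'.PosSemidef := hρ.1.mul_mul_conjTranspose_same V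
  -- Regrouping `A ⊗ (c ⊗ E)` as `(A ⊗ c) ⊗ E` lets the environment `E` be traced out while `A ⊗ c`
  -- is retained.
  set e := Equiv.prodAssoc (Fin dA) c (Fin dB × c)
  set R := R'.submatrix e e with hR
  have hRp : R.PosSemidef := hR'p.submatrix e
  have hσ : traceB R = idTensor Φ ρ := by
    ext ⟨i, m⟩ ⟨j, m'⟩
    simp only [idTensor, hrep, of_apply, traceB, hR, hR', submatrix_apply, hVdef]
    refine Finset.sum_congr rfl fun r _ => ?_
    simp [e, mul_apply, Fintype.sum_prod_type, one_apply, apply_ite (starRingEnd ℂ)]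
  have hf : (traceA (CFC.sqrt ρ) ^ 2).trace = (traceA (CFC.sqrt R') ^ 2).trace := by
    rw [hR', sqrt_conj hρ.1 hV, hVh, hVdef, traceA_one_kronecker_mul_mul, pow_two (W * _ * _),
      conj_mul_conj hW, trace_conj hW, pow_two]
  rw [hf, pow_two, pow_two, ← sum_trace_single, ← sum_trace_single, Complex.re_sum,
    Complex.re_sum]
  refine Finset.sum_le_sum fun p _ => ?_
  -- The test operators are matrix units of `A` only, extended by the identity on `c`, so that their
  -- sum gives `tr (tr_A √·)²` both before and after tracing out the environment.
  have h := re_trace_sqrt_le_traceB hRp (hσ ▸ hΦ.1 dA ρ hρ.1)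
    (single p.1 p.2 (1 : ℂ) ⊗ₖ (1 : Matrix c c ℂ))
  rw [hσ] at h
  refine le_trans (le_of_eq ?_) h
  have hk : (single p.1 p.2 (1 : ℂ) ⊗ₖ (1 : Matrix c c ℂ)) ⊗ₖ
      (1 : Matrix (Fin dB × c) (Fin dB × c) ℂ) = (single p.1 p.2 (1 : ℂ) ⊗ₖ
      (1 : Matrix (c × (Fin dB × c)) (c × (Fin dB × c)) ℂ)).submatrix e e := by
    rw [← one_kronecker_one (m := c), ← kronecker_assoc]
    rfl
  rw [hk, hR, sqrt_submatrix_equiv e hR'p, conjTranspose_submatrix, submatrix_mul_equiv,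
    submatrix_mul_equiv, submatrix_mul_equiv, trace_submatrix_equiv]

/-! ### Consequences of the closed form -/

theorem Qmub_eq {dA dB : ℕ} {B : Fin (dA + 1) → ONB dA} (hB : IsCompleteMUB B)
    {ρ : Matrix (Fin dA × Fin dB) (Fin dA × Fin dB) ℂ} (hρ : IsState ρ) :
    Qmub B ρ = (((CFC.sqrt (traceB ρ)).trace ^ 2).re - (traceA (CFC.sqrt ρ) ^ 2).trace.re) /
      ((dA : ℝ) + 1) := by
  have h := congrArg Complex.re (coe_Qmub hB hρ)
  rw [Complex.ofReal_re, show ((dA : ℂ) + 1) = (((dA : ℝ) + 1 : ℝ) : ℂ) by push_cast; rfl,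
    Complex.div_ofReal_re, Complex.sub_re] at h
  exact h

/-- The bases stay fixed while the state rotates; this is harmless because the closed form does not
mention them. -/
theorem Qmub_unitary_conj {dA dB : ℕ} {B : Fin (dA + 1) → ONB dA} (hB : IsCompleteMUB B)
    {ρ : Matrix (Fin dA × Fin dB) (Fin dA × Fin dB) ℂ} (hρ : IsState ρ)
    {U : Matrix (Fin dA) (Fin dA) ℂ} (hU : Uᴴ * U = 1)
    {V : Matrix (Fin dB) (Fin dB) ℂ} (hV : Vᴴ * V = 1) :
    Qmub B ((U ⊗ₖ V) * ρ * (U ⊗ₖ V)ᴴ) = Qmub B ρ := by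
  have hUV : (U ⊗ₖ V)ᴴ * (U ⊗ₖ V) = 1 := by
    rw [conjTranspose_kronecker, ← mul_kronecker_mul, hU, hV, one_kronecker_one]
  have hρ' : IsState ((U ⊗ₖ V) * ρ * (U ⊗ₖ V)ᴴ) :=
    ⟨hρ.1.mul_mul_conjTranspose_same _, by rw [trace_conj hUV, hρ.2]⟩
  rw [Qmub_eq hB hρ', Qmub_eq hB hρ, sqrt_conj hρ.1 hUV, traceB_kronecker_conj U hV,
    traceA_kronecker_conj hU, sqrt_conj hρ.traceB.1 hU, trace_conj hU, pow_two (V * _ * _),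
    conj_mul_conj hV, trace_conj hV, pow_two (traceA _)]

end AvgCorrelation

open AvgCorrelation
theorem proposition1 (dA dB : ℕ) (B : Fin (dA + 1) → ONB dA) (hB : IsCompleteMUB B)
    (ρ : Matrix (Fin dA × Fin dB) (Fin dA × Fin dB) ℂ) (hρ : IsState ρ) :
    -- non-negativity, and vanishing on product states
    (0 ≤ Qmub B ρ ∧ (ρ = traceB ρ ⊗ₖ traceA ρ → Qmub B ρ = 0)) ∧
    -- contractivity under channels on the second party
    (∀ (dB' : ℕ) (Φ : Matrix (Fin dB) (Fin dB) ℂ →ₗ[ℂ] Matrix (Fin dB') (Fin dB') ℂ),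
      IsChannel Φ → Qmub B (idTensor Φ ρ) ≤ Qmub B ρ) ∧
    -- local unitary invariance
    (∀ UA ∈ Matrix.unitaryGroup (Fin dA) ℂ, ∀ UB ∈ Matrix.unitaryGroup (Fin dB) ℂ,
      Qmub B ((UA ⊗ₖ UB) * ρ * (UA ⊗ₖ UB)ᴴ) = Qmub B ρ) ∧
    -- closed form
    (Qmub B ρ : ℂ) =
      ((CFC.sqrt (traceB ρ)).trace ^ 2 - (traceA (CFC.sqrt ρ) ^ 2).trace) / ((dA : ℂ) + 1) := by
  refine ⟨⟨?_, fun hprod => ?_⟩, fun dB' Φ hΦ => ?_, fun UA hUA UB hUB => ?_, coe_Qmub hB hρ⟩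
  · rw [Qmub_eq hB hρ]
    exact div_nonneg (sub_nonneg.2 (re_trace_traceA_sqrt_sq_le hρ)) (by positivity)
  -- For a product state each `correlation` already vanishes by definition, its two terms being the
  -- same.
  · simp only [Qmub, correlation, ← hprod, sub_self, Finset.sum_const_zero, mul_zero]
  · obtain ⟨hst, htr⟩ := hΦ.isState_idTensor hρ
    rw [Qmub_eq hB hρ, Qmub_eq hB hst, htr]
    exact div_le_div_of_nonneg_right
      (sub_le_sub_left (hΦ.re_trace_traceA_sqrt_sq_le hρ) _) (by positivity)
  · exact Qmub_unitary_conj hB hρ (mem_unitaryGroup_iff'.1 hUA) (mem_unitaryGroup_iff'.1 hUB)
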